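/- For integers $\ell,n,m\ge 0$ let $\Sigma_{\ell,n,m}$ be the set of triples $[E,A,B]$ of real matrices with $E,A\in\mathbb R^{\ell\times n}$ and $B\in\mathbb R^{\ell\times m}$. Two systems $[E_1,A_1,B_1],[E_2,A_2,B_2]\in\Sigma_{\ell,n,m}$ are called P-feedback equivalent, written $[E_1,A_1,B_1]\cong_P[E_2,A_2,B_2]$, if there are invertible matrices $S\in\mathbb R^{\ell\times\ell}$, $T\in\mathbb R^{n\times n}$, $V\in\mathbb R^{m\times m}$ and a matrix $F\in\mathbb R^{m\times n}$ with $$[\,sE_1-A_1,\ -B_1\,]=S\,[\,sE_2-A_2,\ -B_2\,]\begin{bmatrix}T&0\\F&V\end{bmatrix}$$ as polynomial matrices in $s$. A system in $\Sigma_{\ell,n,m}$ is in quasi P-feedback form (QPFF), with block sizes $\ell=\ell_1+\ell_2+\ell_3$, $n=n_1+n_2+n_3$, $m=m_1+m_2+m_3$ (each summand may be zero), if it has the form $$\left[\begin{bmatrix}E_{11}&E_{12}&E_{13}\\0&E_{22}&E_{23}\\0&0&E_{33}\end{bmatrix},\begin{bmatrix}A_{11}&A_{12}&A_{13}\\0&A_{22}&A_{23}\\0&0&A_{33}\end{bmatrix},\begin{bmatrix}B_{11}&0&B_{13}\\0&0&0\\0&0&B_{33}\end{bmatrix}\right]$$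 with $E_{kj},A_{kj}\in\mathbb R^{\ell_k\times n_j}$ and $B_{kj}\in\mathbb R^{\ell_k\times m_j}$, where (i) $\ell_1<n_1+m_1$ or $\ell_1=n_1=m_1=0$; moreover $\operatorname{rk}E_{11}=\operatorname{rk}_{\mathbb C}[\lambda E_{11}-A_{11},B_{11}]=\ell_1$ for all $\lambda\in\mathbb C$, and $\operatorname{rk}B_{11}=m_1$; (ii) $\ell_2=n_2$ and $E_{22}$ is invertible; (iii) $\operatorname{rk}_{\mathbb C}[\lambda E_{33}-A_{33},B_{33}]=n_3+m_3$ for all $\lambda\in\mathbb C$. **Proposition.** Let $[E,A,B]\in\Sigma_{\ell,n,m}$, and for $i=1,2$ let $[E^i,A^i,B^i]\in\Sigma_{\ell,n,m}$ be in QPFF, with block sizes $\ell^i_k,n^i_k,m^i_k$ and blocks $E^i_{kj},A^i_{kj},B^i_{kj}$, such that $[E,A,B]\cong_P[E^i,A^i,B^i]$. Put $B^i_{22}:=0\in\mathbb R^{\ell^i_2\times m^i_2}$. Then for $k=1,2,3$ $$\ell^1_k=\ell^2_k,\qquad n^1_k=n^2_k,\qquad m^1_k=m^2_k,\qquad [E^1_{kk},A^1_{kk},B^1_{kk}]\cong_P[E^2_{kk},A^2_{kk},B^2_{kk}].$$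 -/

import Mathlib

/-- A system `[E, A, B] ∈ Σ_{ℓ,n,m}`: real matrices `E, A` of size `ℓ × n` and `B` of size
`ℓ × m` (sizes may be zero). -/
structure ControlSystem (ℓ n m : ℕ) where
  E : Matrix (Fin ℓ) (Fin n) ℝ
  A : Matrix (Fin ℓ) (Fin n) ℝ
  B : Matrix (Fin ℓ) (Fin m) ℝ

/-- A partition `size 0 + size 1 + size 2 = n` of `n` indices into three consecutive
(possibly empty) blocks; the blocks `1, 2, 3` of the mathematical text are `0, 1, 2` here. -/
structure ThreeBlocks (n : ℕ) where
  size : Fin 3 → ℕ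
  sum_size : ∑ k, size k = n

/-- The index, among all `n` indices, of the `i`-th index of the `k`-th block: the blocks are
listed one after the other, in the order `0, 1, 2`. -/
def ThreeBlocks.idx {n : ℕ} (p : ThreeBlocks n) (k : Fin 3) (i : Fin (p.size k)) : Fin n :=
  Fin.cast p.sum_size (finSigmaFinEquiv ⟨k, i⟩)

/-- The `(i, j)` block of a matrix with respect to partitions of its rows and columns. -/
def Matrix.threeBlock {r c : ℕ} (M : Matrix (Fin r) (Fin c) ℝ) (p : ThreeBlocks r)
    (q : ThreeBlocks c) (i j : Fin 3) : Matrix (Fin (p.size i)) (Fin (q.size j)) ℝ :=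
  M.submatrix (p.idx i) (q.idx j)

namespace ControlSystem

/-- The polynomial matrix `[sE - A, -B]`. -/
noncomputable def pencil {ℓ n m : ℕ} (G : ControlSystem ℓ n m) :
    Matrix (Fin ℓ) (Fin n ⊕ Fin m) (Polynomial ℝ) :=
  Matrix.fromCols
    ((Polynomial.X : Polynomial ℝ) • G.E.map Polynomial.C - G.A.map Polynomial.C)
    (-(G.B.map Polynomial.C))

/-- P-feedback equivalence `[E₁, A₁, B₁] ≅_P [E₂, A₂, B₂]`:
`[sE₁ - A₁, -B₁] = S [sE₂ - A₂, -B₂] [T 0; F V]` for some invertible `S, T, V` and some `F`. -/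
def PFeedbackEquiv {ℓ n m : ℕ} (G₁ G₂ : ControlSystem ℓ n m) : Prop :=
  ∃ (S : Matrix.GeneralLinearGroup (Fin ℓ) ℝ) (T : Matrix.GeneralLinearGroup (Fin n) ℝ)
    (V : Matrix.GeneralLinearGroup (Fin m) ℝ) (F : Matrix (Fin m) (Fin n) ℝ),
    G₁.pencil = S.val.map Polynomial.C * G₂.pencil *
      Matrix.fromBlocks (T.val.map Polynomial.C) 0 (F.map Polynomial.C) (V.val.map Polynomial.C)

/-- The same system, with its sizes rewritten along equalities of natural numbers. -/
def cast {ℓ n m ℓ' n' m' : ℕ} (hℓ : ℓ = ℓ') (hn : n = n') (hm : m = m')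
    (G : ControlSystem ℓ n m) : ControlSystem ℓ' n' m' where
  E := G.E.submatrix (Fin.cast hℓ.symm) (Fin.cast hn.symm)
  A := G.A.submatrix (Fin.cast hℓ.symm) (Fin.cast hn.symm)
  B := G.B.submatrix (Fin.cast hℓ.symm) (Fin.cast hm.symm)

/-- The `k`-th diagonal block `[E_kk, A_kk, B_kk]`. -/
def diagBlock {ℓ n m : ℕ} (G : ControlSystem ℓ n m) (pℓ : ThreeBlocks ℓ) (pn : ThreeBlocks n)
    (pm : ThreeBlocks m) (k : Fin 3) :
    ControlSystem (pℓ.size k) (pn.size k) (pm.size k) where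
  E := G.E.threeBlock pℓ pn k k
  A := G.A.threeBlock pℓ pn k k
  B := G.B.threeBlock pℓ pm k k

/-- The complex matrix `[z E - A, B]`. -/
noncomputable def complexPencil {ℓ n m : ℕ} (G : ControlSystem ℓ n m) (z : ℂ) :
    Matrix (Fin ℓ) (Fin n ⊕ Fin m) ℂ :=
  Matrix.fromCols (z • G.E.map Complex.ofReal - G.A.map Complex.ofReal)
    (G.B.map Complex.ofReal)

/-- Condition on the first diagonal block: `ℓ < n + m`, and `E`, all `[z E - A, B]`, `z ∈ ℂ`,
have full row rank and `B` has full column rank. As usual for block decompositions, the block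
may also be absent (`ℓ = n = m = 0`). -/
def IsControllableBlock {ℓ n m : ℕ} (G : ControlSystem ℓ n m) : Prop :=
  (ℓ < n + m ∨ (ℓ = 0 ∧ n = 0 ∧ m = 0)) ∧
    G.E.rank = ℓ ∧ (∀ z : ℂ, (G.complexPencil z).rank = ℓ) ∧ G.B.rank = m

/-- Condition on the second diagonal block: `E` is square and invertible. -/
def IsODEBlock {ℓ n m : ℕ} (G : ControlSystem ℓ n m) : Prop :=
  ∃ h : ℓ = n, IsUnit (G.E.submatrix id (Fin.cast h))

/-- Condition on the third diagonal block: all `[z E - A, B]`, `z ∈ ℂ`, have full column rank. -/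
def IsConstrainedBlock {ℓ n m : ℕ} (G : ControlSystem ℓ n m) : Prop :=
  ∀ z : ℂ, (G.complexPencil z).rank = n + m

/-- `G` is in quasi P-feedback form (QPFF) with respect to the given block sizes:
`E` and `A` are block upper triangular, `B` has the block pattern
`[B₁₁ 0 B₁₃; 0 0 0; 0 0 B₃₃]`, and the diagonal blocks satisfy the three conditions above. -/
structure IsQPFF {ℓ n m : ℕ} (G : ControlSystem ℓ n m) (pℓ : ThreeBlocks ℓ)
    (pn : ThreeBlocks n) (pm : ThreeBlocks m) : Prop where
  E_upper : ∀ i j : Fin 3, j < i → G.E.threeBlock pℓ pn i j = 0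
  A_upper : ∀ i j : Fin 3, j < i → G.A.threeBlock pℓ pn i j = 0
  B_row : ∀ j : Fin 3, G.B.threeBlock pℓ pm 1 j = 0
  B_col : ∀ i : Fin 3, G.B.threeBlock pℓ pm i 1 = 0
  B_corner : G.B.threeBlock pℓ pm 2 0 = 0
  first : (G.diagBlock pℓ pn pm 0).IsControllableBlock
  second : (G.diagBlock pℓ pn pm 1).IsODEBlock
  third : (G.diagBlock pℓ pn pm 2).IsConstrainedBlock

end ControlSystem

/-! Composing the two equivalences gives invertible S, T, V and some F with S E₁ = E₂ T, S A₁ = A₂ T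
+ B₂ F, S B₁ = B₂ V. Cut them into blocks, rows by the second partition and columns by the first. No
nonzero morphism leads from the controllable block to the ODE or constrained block, nor from the ODE
block to the constrained one, so S and T are block upper triangular; V is too once its blocks are
ordered 1, 0, 2 (`Intertwines.blockPattern`). The inverse transformation has the same shape, so
corresponding diagonal blocks are mutually inverse. This forces equal sizes and gives the
equivalence of diagonal blocks.

The morphisms vanish because the equation A X + B Y = E X M has only the zero solution when [zE - A,
B] has full column rank at every complex z (`IsConstrainedBlock.eq_zero`);
`eq_zero_of_rank_complexPencil` is the dual for full row rank. Both follow from Cayley–Hamilton over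
ℂ, removing one linear factor of the characteristic polynomial at a time. -/

/-! ### Full-rank matrices and block multiplication. -/

namespace Matrix

/-- The columns of a matrix of full column rank are linearly independent. -/
theorem eq_zero_of_mul_eq_zero_of_rank_eq_card {K m n o : Type*} [Field K] [Fintype m] [Fintype n]
    [Fintype o] (P : Matrix m n K) (hP : P.rank = Fintype.card n) {W : Matrix n o K}
    (h : P * W = 0) : W = 0 := by
  classical
  have hinj : Function.Injective P.mulVecLin := by
    rw [← LinearMap.ker_eq_bot, ← Submodule.finrank_eq_zero]
    have := P.mulVecLin.finrank_range_add_finrank_ker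
    rw [Module.finrank_fintype_fun_eq_card] at this
    unfold Matrix.rank at hP
    omega
  ext i j
  have h0 : P.mulVecLin (W.col j) = P.mulVecLin 0 := by
    rw [map_zero]
    ext k
    exact congrFun (congrFun h k) j
  exact congrFun (hinj h0) i

/-- The rows of a matrix of full row rank are linearly independent. -/
theorem eq_zero_of_mul_eq_zero_of_rank_eq_card_rows {K m n o : Type*} [Field K] [Fintype m]
    [Fintype n] [Fintype o] (P : Matrix m n K) (hP : P.rank = Fintype.card m) {W : Matrix o m K}
    (h : W * P = 0) : W = 0 := by
  rw [← transpose_eq_zero]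
  refine eq_zero_of_mul_eq_zero_of_rank_eq_card Pᵀ (by rw [rank_transpose, hP]) ?_
  rw [← transpose_mul, h, transpose_zero]

/-- A matrix of full row rank has a right inverse. -/
theorem exists_mul_eq_one_of_rank_eq_card {K m n : Type*} [Field K] [Fintype m] [Fintype n]
    [DecidableEq m] (P : Matrix m n K) (hP : P.rank = Fintype.card m) :
    ∃ R : Matrix n m K, P * R = 1 := by
  rw [← mulVec_surjective_iff_exists_right_inverse]
  change Function.Surjective P.mulVecLin
  rw [← LinearMap.range_eq_top]
  apply Submodule.eq_top_of_finrank_eq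
  rw [Module.finrank_fintype_fun_eq_card, ← hP]
  rfl

theorem map_eq_zero_of_injective {R S m n : Type*} [Semiring R] [Semiring S] (f : R →+* S)
    (hf : Function.Injective f) {M : Matrix m n R} (h : M.map f = 0) : M = 0 := by
  ext i j
  apply hf
  exact (congrFun (congrFun h i) j).trans (map_zero f).symm

/-- A matrix with a two-sided inverse is square. -/
theorem size_eq_of_mul_eq_one {a b : ℕ} (P : Matrix (Fin a) (Fin b) ℝ)
    (Q : Matrix (Fin b) (Fin a) ℝ) (h : P * Q = 1) (h' : Q * P = 1) : a = b := by
  simpa using square_of_invertible P Q h h'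

/-- Block multiplication of matrices. -/
theorem threeBlock_mul {a b c : ℕ} (M : Matrix (Fin a) (Fin b) ℝ) (N : Matrix (Fin b) (Fin c) ℝ)
    (p : ThreeBlocks a) (q : ThreeBlocks b) (r : ThreeBlocks c) (i j : Fin 3) :
    (M * N).threeBlock p r i j =
      M.threeBlock p q i 0 * N.threeBlock q r 0 j + M.threeBlock p q i 1 * N.threeBlock q r 1 j
        + M.threeBlock p q i 2 * N.threeBlock q r 2 j := by
  ext x y
  simp only [threeBlock, submatrix_apply, mul_apply, add_apply]
  rw [← (finSigmaFinEquiv.trans (finCongr q.sum_size)).sum_comp, Fintype.sum_sigma,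
    Fin.sum_univ_three]
  rfl

theorem threeBlock_one {a : ℕ} (p : ThreeBlocks a) (i : Fin 3) :
    (1 : Matrix (Fin a) (Fin a) ℝ).threeBlock p p i i = 1 := by
  refine submatrix_one _ fun x y h => ?_
  have := finSigmaFinEquiv.injective (Fin.cast_injective p.sum_size h)
  simpa using this

theorem threeBlock_add {a b : ℕ} (M N : Matrix (Fin a) (Fin b) ℝ)
    (p : ThreeBlocks a) (q : ThreeBlocks b) (i j : Fin 3) :
    (M + N).threeBlock p q i j = M.threeBlock p q i j + N.threeBlock p q i j := rfl

end Matrix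

/-! ### Sylvester-type equations with only the zero solution. -/

namespace ControlSystem

open Matrix

/-- If `[z E - A, B]` has full column rank for all complex `z`, then the only solution of
`A X + B Y = E X M` is zero. -/
theorem IsConstrainedBlock.eq_zero {ℓ n m k : ℕ} {G : ControlSystem ℓ n m}
    (hG : G.IsConstrainedBlock) {X : Matrix (Fin n) (Fin k) ℝ} {M : Matrix (Fin k) (Fin k) ℝ}
    {Y : Matrix (Fin m) (Fin k) ℝ} (h : G.A * X + G.B * Y = G.E * X * M) : X = 0 ∧ Y = 0 := by
  -- The case where M is the scalar z: the stacked matrix (Z, -W) lies in the kernel of [zE - A, B].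
  have key : ∀ (z : ℂ) (Z : Matrix (Fin n) (Fin k) ℂ) (W : Matrix (Fin m) (Fin k) ℂ),
      G.A.map Complex.ofReal * Z + G.B.map Complex.ofReal * W = z • (G.E.map Complex.ofReal * Z) →
      Z = 0 ∧ W = 0 := by
    intro z Z W hZ
    have h0 : fromRows Z (-W) = 0 := by
      apply eq_zero_of_mul_eq_zero_of_rank_eq_card (G.complexPencil z) (by simp [hG z])
      rw [complexPencil, fromCols_mul_fromRows, Matrix.sub_mul, Matrix.smul_mul, ← hZ]
      simp
    constructor
    · ext i j
      exact congrFun (congrFun h0 (Sum.inl i)) j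
    · ext i j
      have := congrFun (congrFun h0 (Sum.inr i)) j
      simpa using this
  have hc : G.A.map Complex.ofReal * X.map Complex.ofReal
      + G.B.map Complex.ofReal * Y.map Complex.ofReal
      = G.E.map Complex.ofReal * X.map Complex.ofReal * M.map Complex.ofReal := by
    have := congrArg (fun N : Matrix _ _ ℝ => N.map Complex.ofRealHom) h
    simp only [Matrix.map_mul, Matrix.map_add _ (map_add Complex.ofRealHom)] at this
    exact this
  set Mc := M.map Complex.ofReal
  set Xc := X.map Complex.ofReal
  -- If X (M - a) N = 0, then X N satisfies the equation with the scalar a in place of M, so `key`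
  -- gives X N = 0 and the factor M - a drops out.
  have strip : ∀ s : Multiset ℂ,
      Xc * Polynomial.aeval Mc (s.map fun a => Polynomial.X - Polynomial.C a).prod = 0 →
      Xc = 0 := by
    intro s
    induction s using Multiset.induction with
    | empty => simp
    | cons a s ih =>
      intro hs
      apply ih
      rw [Multiset.map_cons, Multiset.prod_cons, map_mul] at hs
      set N := Polynomial.aeval Mc (s.map fun a => Polynomial.X - Polynomial.C a).prod
      refine (key a (Xc * N) (Y.map Complex.ofReal * N) ?_).1
      have h1 : Xc * (Mc * N) = a • (Xc * N) := by
        simpa [Matrix.sub_mul, Matrix.mul_sub, sub_eq_zero, Algebra.algebraMap_eq_smul_one]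
          using hs
      calc _ = (G.A.map Complex.ofReal * Xc
              + G.B.map Complex.ofReal * Y.map Complex.ofReal) * N := by
            simp only [Matrix.add_mul, Matrix.mul_assoc]
        _ = G.E.map Complex.ofReal * (Xc * (Mc * N)) := by
            rw [hc]; simp only [Matrix.mul_assoc]
        _ = _ := by rw [h1, Matrix.mul_smul]
  -- By Cayley–Hamilton the product over all characteristic roots annihilates X.
  have hX : Xc = 0 := by
    apply strip Mc.charpoly.roots
    rw [← (IsAlgClosed.splits Mc.charpoly).eq_prod_roots_of_monic Mc.charpoly_monic,
      Matrix.aeval_self_charpoly, Matrix.mul_zero]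
  refine ⟨map_eq_zero_of_injective Complex.ofRealHom Complex.ofReal_injective hX, ?_⟩
  refine map_eq_zero_of_injective Complex.ofRealHom Complex.ofReal_injective
    (key 0 Xc (Y.map Complex.ofReal) ?_).2
  rw [hc, hX]
  simp

/-- If `[z E - A, B]` has full row rank for all complex `z`, then the only solution of
`K A = N K E`, `K B = 0` is zero. -/
theorem eq_zero_of_rank_complexPencil {ℓ n m k : ℕ} {G : ControlSystem ℓ n m}
    (hG : ∀ z, (G.complexPencil z).rank = ℓ) {K : Matrix (Fin k) (Fin ℓ) ℝ}
    {N : Matrix (Fin k) (Fin k) ℝ} (hA : K * G.A = N * (K * G.E)) (hB : K * G.B = 0) :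
    K = 0 := by
  have key : ∀ (z : ℂ) (Z : Matrix (Fin k) (Fin ℓ) ℂ),
      Z * G.A.map Complex.ofReal = z • (Z * G.E.map Complex.ofReal) →
      Z * G.B.map Complex.ofReal = 0 → Z = 0 := by
    intro z Z hZ hZB
    apply eq_zero_of_mul_eq_zero_of_rank_eq_card_rows (G.complexPencil z) (by simp [hG z])
    rw [complexPencil, mul_fromCols, Matrix.mul_sub, Matrix.mul_smul, ← hZ, hZB]
    simp
  have hAc : K.map Complex.ofReal * G.A.map Complex.ofReal
      = N.map Complex.ofReal * (K.map Complex.ofReal * G.E.map Complex.ofReal) := by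
    have := congrArg (fun N : Matrix _ _ ℝ => N.map Complex.ofRealHom) hA
    simp only [Matrix.map_mul] at this
    exact this
  have hBc : K.map Complex.ofReal * G.B.map Complex.ofReal = 0 := by
    have := congrArg (fun N : Matrix _ _ ℝ => N.map Complex.ofRealHom) hB
    simp only [Matrix.map_mul, Matrix.map_zero _ (map_zero Complex.ofRealHom)] at this
    exact this
  set Nc := N.map Complex.ofReal
  set Kc := K.map Complex.ofReal
  have strip : ∀ s : Multiset ℂ,
      Polynomial.aeval Nc (s.map fun a => Polynomial.X - Polynomial.C a).prod * Kc = 0 →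
      Kc = 0 := by
    intro s
    induction s using Multiset.induction with
    | empty => simp
    | cons a s ih =>
      intro hs
      apply ih
      -- Commuting the polynomial factors puts N - a next to K, where the equation for K A applies.
      rw [Multiset.map_cons, Multiset.prod_cons, mul_comm, map_mul] at hs
      set Q := Polynomial.aeval Nc (s.map fun a => Polynomial.X - Polynomial.C a).prod
      have h1 : Q * Nc * Kc = a • (Q * Kc) := by
        simpa [Matrix.sub_mul, Matrix.mul_sub, sub_eq_zero, Algebra.algebraMap_eq_smul_one]
          using hs
      refine key a (Q * Kc) ?_ (by rw [Matrix.mul_assoc, hBc, Matrix.mul_zero])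
      rw [Matrix.mul_assoc, hAc, ← Matrix.smul_mul, ← h1]
      simp only [Matrix.mul_assoc]
  have hK : Kc = 0 := by
    apply strip Nc.charpoly.roots
    rw [← (IsAlgClosed.splits Nc.charpoly).eq_prod_roots_of_monic Nc.charpoly_monic,
      Matrix.aeval_self_charpoly, Matrix.zero_mul]
  exact map_eq_zero_of_injective Complex.ofRealHom Complex.ofReal_injective hK

/-! ### The category-like calculus of feedback transformations. -/

/-- `S [sE₁ - A₁, -B₁] = [sE₂ - A₂, -B₂] [T 0; F V]`, coefficient by coefficient, for systems of
possibly different sizes. -/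
structure Intertwines {ℓ n m ℓ' n' m' : ℕ} (G₁ : ControlSystem ℓ n m)
    (G₂ : ControlSystem ℓ' n' m') (S : Matrix (Fin ℓ') (Fin ℓ) ℝ) (T : Matrix (Fin n') (Fin n) ℝ)
    (V : Matrix (Fin m') (Fin m) ℝ) (F : Matrix (Fin m') (Fin n) ℝ) : Prop where
  E_eq : S * G₁.E = G₂.E * T
  A_eq : S * G₁.A = G₂.A * T + G₂.B * F
  B_eq : S * G₁.B = G₂.B * V

/-- The new feedback matrix is the lower left corner of [T' 0; F' V'] [T 0; F V]. -/
theorem Intertwines.comp {ℓ n m ℓ' n' m' ℓ'' n'' m'' : ℕ} {G₁ : ControlSystem ℓ n m}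
    {G₂ : ControlSystem ℓ' n' m'} {G₃ : ControlSystem ℓ'' n'' m''} {S T V F S' T' V' F'}
    (h : G₁.Intertwines G₂ S T V F) (h' : G₂.Intertwines G₃ S' T' V' F') :
    G₁.Intertwines G₃ (S' * S) (T' * T) (V' * V) (F' * T + V' * F) where
  E_eq := by rw [Matrix.mul_assoc, h.E_eq, ← Matrix.mul_assoc, h'.E_eq, Matrix.mul_assoc]
  A_eq := by
    rw [Matrix.mul_assoc, h.A_eq, Matrix.mul_add, ← Matrix.mul_assoc, ← Matrix.mul_assoc, h'.A_eq,
      h'.B_eq]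
    simp only [Matrix.mul_add, Matrix.add_mul, Matrix.mul_assoc, add_assoc]
  B_eq := by rw [Matrix.mul_assoc, h.B_eq, ← Matrix.mul_assoc, h'.B_eq, Matrix.mul_assoc]

/-- The new feedback matrix is the lower left corner of the inverse of [T 0; F V]. -/
theorem Intertwines.symm {ℓ n m ℓ' n' m' : ℕ} {G₁ : ControlSystem ℓ n m}
    {G₂ : ControlSystem ℓ' n' m'} {S T V F}
    {S' : Matrix (Fin ℓ) (Fin ℓ') ℝ} {T' : Matrix (Fin n) (Fin n') ℝ}
    {V' : Matrix (Fin m) (Fin m') ℝ}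
    (h : G₁.Intertwines G₂ S T V F) (hS : S' * S = 1) (hT : T * T' = 1) (hV : V * V' = 1) :
    G₂.Intertwines G₁ S' T' V' (-(V' * F * T')) where
  E_eq := by
    calc S' * G₂.E = S' * (G₂.E * T) * T' := by simp only [Matrix.mul_assoc, hT, Matrix.mul_one]
      _ = G₁.E * T' := by rw [← h.E_eq, ← Matrix.mul_assoc, hS, Matrix.one_mul]
  B_eq := by
    calc S' * G₂.B = S' * (G₂.B * V) * V' := by simp only [Matrix.mul_assoc, hV, Matrix.mul_one]
      _ = G₁.B * V' := by rw [← h.B_eq, ← Matrix.mul_assoc, hS, Matrix.one_mul]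
  A_eq := by
    have hB : S' * (G₂.B * F) = G₁.B * (V' * F) := by
      calc S' * (G₂.B * F) = S' * (G₂.B * V) * (V' * F) := by
            simp only [Matrix.mul_assoc]
            rw [← Matrix.mul_assoc V, hV, Matrix.one_mul]
        _ = _ := by
          rw [← h.B_eq, ← Matrix.mul_assoc S', hS, Matrix.one_mul]
    calc S' * G₂.A = S' * (G₂.A * T) * T' := by simp only [Matrix.mul_assoc, hT, Matrix.mul_one]
      _ = _ := by
        rw [eq_sub_of_add_eq h.A_eq.symm, Matrix.mul_sub, hB, ← Matrix.mul_assoc, hS,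
          Matrix.one_mul, Matrix.sub_mul]
        simp only [Matrix.mul_assoc, Matrix.mul_neg, sub_eq_add_neg]

/-- Moving S to the left as S⁻¹ gives identities that compose and still make sense for blocks of
different sizes. -/
theorem PFeedbackEquiv.exists_eq {ℓ n m : ℕ} {G₁ G₂ : ControlSystem ℓ n m}
    (h : G₁.PFeedbackEquiv G₂) :
    ∃ (S : GL (Fin ℓ) ℝ) (T : GL (Fin n) ℝ) (V : GL (Fin m) ℝ) (F : Matrix (Fin m) (Fin n) ℝ),
      G₁.Intertwines G₂ (S⁻¹).val T.val V.val F := by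
  obtain ⟨S, T, V, F, h⟩ := h
  refine ⟨S, T, V, F, ?_⟩
  have hS : S⁻¹.val * S.val = 1 := by rw [← Units.val_mul, inv_mul_cancel, Units.val_one]
  -- The pencil is affine in s, so its values at 0 and 1 recover A and E.
  have hz : ∀ z : ℝ,
      z • G₁.E - G₁.A = S.val * (z • G₂.E - G₂.A) * T.val - S.val * G₂.B * F ∧
      G₁.B = S.val * G₂.B * V.val := by
    intro z
    have h' := congrArg (fun N : Matrix _ _ (Polynomial ℝ) => N.map (Polynomial.evalRingHom z)) h
    simp only [Matrix.map_mul] at h'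
    have hp : ∀ G : ControlSystem ℓ n m, G.pencil.map (Polynomial.evalRingHom z)
        = fromCols (z • G.E - G.A) (-G.B) := by
      intro G
      ext i (j | j)
      · simp [pencil, mul_comm z]
      · simp [pencil]
    have hC : ∀ {a b : ℕ} (M : Matrix (Fin a) (Fin b) ℝ),
        (M.map Polynomial.C).map (Polynomial.evalRingHom z) = M := by
      intro a b M
      ext i j
      simp
    rw [fromBlocks_map, hp, hp, hC, hC, hC, hC, Matrix.map_zero _ (map_zero _), mul_fromCols,
      fromCols_mul_fromBlocks, fromCols_ext_iff] at h'
    constructor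
    · simpa [sub_eq_add_neg] using h'.1
    · simpa using h'.2
  have h0 := (hz 0).1
  have h1 := (hz 1).1
  simp only [zero_smul, zero_sub, one_smul, Matrix.mul_neg, Matrix.neg_mul, Matrix.mul_sub,
    Matrix.sub_mul] at h0 h1
  have hE : G₁.E = S.val * G₂.E * T.val := by
    rw [sub_eq_iff_eq_add] at h1
    rw [h1, neg_eq_iff_eq_neg.1 h0]
    abel
  have hA : G₁.A = S.val * G₂.A * T.val + S.val * G₂.B * F := by
    rw [neg_eq_iff_eq_neg.1 h0]
    abel
  constructor
  · rw [hE, ← Matrix.mul_assoc, ← Matrix.mul_assoc, hS, Matrix.one_mul]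
  · rw [hA, Matrix.mul_add]
    simp only [← Matrix.mul_assoc, hS, Matrix.one_mul]
  · rw [(hz 0).2, ← Matrix.mul_assoc, ← Matrix.mul_assoc, hS, Matrix.one_mul]

theorem Intertwines.pFeedbackEquiv {ℓ n m : ℕ} {G₁ G₂ : ControlSystem ℓ n m}
    {S : GL (Fin ℓ) ℝ} {T : GL (Fin n) ℝ} {V : GL (Fin m) ℝ} {F : Matrix (Fin m) (Fin n) ℝ}
    (h : G₁.Intertwines G₂ (S⁻¹).val T.val V.val F) : G₁.PFeedbackEquiv G₂ := by
  refine ⟨S, T, V, F, ?_⟩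
  have hS : S.val * S⁻¹.val = 1 := by rw [← Units.val_mul, mul_inv_cancel, Units.val_one]
  have hE : G₁.E = S.val * G₂.E * T.val := by
    rw [Matrix.mul_assoc, ← h.E_eq, ← Matrix.mul_assoc, hS, Matrix.one_mul]
  have hA : G₁.A = S.val * G₂.A * T.val + S.val * G₂.B * F := by
    rw [Matrix.mul_assoc, Matrix.mul_assoc, ← Matrix.mul_add, ← h.A_eq, ← Matrix.mul_assoc, hS,
      Matrix.one_mul]
  have hB : G₁.B = S.val * G₂.B * V.val := by
    rw [Matrix.mul_assoc, ← h.B_eq, ← Matrix.mul_assoc, hS, Matrix.one_mul]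
  rw [pencil, pencil, mul_fromCols, fromCols_mul_fromBlocks, hE, hA, hB]
  simp only [Matrix.map_mul, Matrix.map_add _ (map_add Polynomial.C), Matrix.mul_sub,
    Matrix.sub_mul, Matrix.mul_smul, Matrix.smul_mul, Matrix.mul_neg, Matrix.neg_mul,
    Matrix.mul_zero, zero_add]
  congr 1
  abel

/-- Intertwining by invertible matrices forces equal sizes and is P-feedback equivalence. -/
theorem Intertwines.exists_cast_pFeedbackEquiv {ℓ n m ℓ' n' m' : ℕ} {G₁ : ControlSystem ℓ n m}
    {G₂ : ControlSystem ℓ' n' m'} {S T V F}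
    {S' : Matrix (Fin ℓ) (Fin ℓ') ℝ} {T' : Matrix (Fin n) (Fin n') ℝ}
    {V' : Matrix (Fin m) (Fin m') ℝ} (h : G₁.Intertwines G₂ S T V F)
    (hS : S * S' = 1) (hS' : S' * S = 1) (hT : T * T' = 1) (hT' : T' * T = 1)
    (hV : V * V' = 1) (hV' : V' * V = 1) :
    ∃ (hℓ : ℓ = ℓ') (hn : n = n') (hm : m = m'), (G₁.cast hℓ hn hm).PFeedbackEquiv G₂ := by
  obtain rfl := size_eq_of_mul_eq_one S S' hS hS'
  obtain rfl := size_eq_of_mul_eq_one T T' hT hT'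
  obtain rfl := size_eq_of_mul_eq_one V V' hV hV'
  refine ⟨rfl, rfl, rfl, ?_⟩
  -- The intertwining matrix S plays the role of S⁻¹ in the equivalence, so the unit has value S'
  -- and inverse S.
  exact Intertwines.pFeedbackEquiv (S := ⟨S', S, hS', hS⟩) (T := ⟨T, T', hT, hT'⟩)
    (V := ⟨V, V', hV, hV'⟩) h

/-! ### Morphisms between the three kinds of blocks. -/

theorem IsODEBlock.exists_inverse {ℓ n m : ℕ} {G : ControlSystem ℓ n m} (h : G.IsODEBlock) :
    ∃ R : Matrix (Fin n) (Fin ℓ) ℝ, G.E * R = 1 ∧ R * G.E = 1 := by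
  obtain ⟨rfl, u, hu⟩ := h
  change u.val = G.E at hu
  exact ⟨u.inv, hu ▸ u.val_inv, hu ▸ u.inv_val⟩

theorem IsConstrainedBlock.mul_B_eq_zero {ℓ n m k : ℕ} {G : ControlSystem ℓ n m}
    (hG : G.IsConstrainedBlock) {Y : Matrix (Fin m) (Fin k) ℝ} (h : G.B * Y = 0) : Y = 0 :=
  (hG.eq_zero (X := 0) (M := 0) (by simpa using h)).2

/-- Only zero maps a pencil `s E - A` with right-invertible `E` into a constrained block. -/
theorem IsConstrainedBlock.eq_zero_of_rightInverse {ℓ n m ℓ' k : ℕ} {G : ControlSystem ℓ n m}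
    (hG : G.IsConstrainedBlock) {E A : Matrix (Fin ℓ') (Fin k) ℝ} {R : Matrix (Fin k) (Fin ℓ') ℝ}
    (hR : E * R = 1) {S : Matrix (Fin ℓ) (Fin ℓ') ℝ} {X : Matrix (Fin n) (Fin k) ℝ}
    {Y : Matrix (Fin m) (Fin k) ℝ} (hE : S * E = G.E * X) (hA : S * A = G.A * X + G.B * Y) :
    S = 0 ∧ X = 0 ∧ Y = 0 := by
  -- Eliminating S through R leaves A X + B Y = E X M with M = R A.
  have hS : S = G.E * X * R := by rw [← hE, Matrix.mul_assoc, hR, Matrix.mul_one]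
  have h := hG.eq_zero (X := X) (Y := Y) (M := R * A) (by rw [← hA, hS, Matrix.mul_assoc _ R])
  exact ⟨by rw [hS, h.1, Matrix.mul_zero, Matrix.zero_mul], h⟩

/-- The zero pattern of the transformation matrices between two systems in QPFF. -/
structure BlockPattern {ℓ n m : ℕ} (pℓ₁ pℓ₂ : ThreeBlocks ℓ) (pn₁ pn₂ : ThreeBlocks n)
    (pm₁ pm₂ : ThreeBlocks m) (S : Matrix (Fin ℓ) (Fin ℓ) ℝ) (T : Matrix (Fin n) (Fin n) ℝ)
    (V : Matrix (Fin m) (Fin m) ℝ) (F : Matrix (Fin m) (Fin n) ℝ) : Prop where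
  S10 : S.threeBlock pℓ₂ pℓ₁ 1 0 = 0
  S20 : S.threeBlock pℓ₂ pℓ₁ 2 0 = 0
  S21 : S.threeBlock pℓ₂ pℓ₁ 2 1 = 0
  T10 : T.threeBlock pn₂ pn₁ 1 0 = 0
  T20 : T.threeBlock pn₂ pn₁ 2 0 = 0
  T21 : T.threeBlock pn₂ pn₁ 2 1 = 0
  V01 : V.threeBlock pm₂ pm₁ 0 1 = 0
  V20 : V.threeBlock pm₂ pm₁ 2 0 = 0
  V21 : V.threeBlock pm₂ pm₁ 2 1 = 0
  F20 : F.threeBlock pm₂ pn₁ 2 0 = 0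

/-! ### Triangular shape of the transformations and comparison of diagonal blocks. -/

section QPFF

variable {ℓ n m : ℕ} {G₁ G₂ : ControlSystem ℓ n m} {pℓ₁ pℓ₂ : ThreeBlocks ℓ}
  {pn₁ pn₂ : ThreeBlocks n} {pm₁ pm₂ : ThreeBlocks m} {S : Matrix (Fin ℓ) (Fin ℓ) ℝ}
  {T : Matrix (Fin n) (Fin n) ℝ} {V : Matrix (Fin m) (Fin m) ℝ} {F : Matrix (Fin m) (Fin n) ℝ}

/-- The order (2,0), (2,1), (1,0) matters: each vanishing block removes the off-diagonal terms from
a later equation. The blocks of V come last, from the full column rank of the corner blocks of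
`G₂.B`. -/
theorem Intertwines.blockPattern (h : G₁.Intertwines G₂ S T V F)
    (hQ₁ : G₁.IsQPFF pℓ₁ pn₁ pm₁) (hQ₂ : G₂.IsQPFF pℓ₂ pn₂ pm₂) :
    BlockPattern pℓ₁ pℓ₂ pn₁ pn₂ pm₁ pm₂ S T V F := by
  have hE : ∀ i j : Fin 3, _ := fun i j =>
    congrArg (fun M : Matrix _ _ ℝ => M.threeBlock pℓ₂ pn₁ i j) h.E_eq
  have hA : ∀ i j : Fin 3, _ := fun i j =>
    congrArg (fun M : Matrix _ _ ℝ => M.threeBlock pℓ₂ pn₁ i j) h.A_eq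
  have hB : ∀ i j : Fin 3, _ := fun i j =>
    congrArg (fun M : Matrix _ _ ℝ => M.threeBlock pℓ₂ pm₁ i j) h.B_eq
  simp only [threeBlock_add, threeBlock_mul _ _ pℓ₂ pℓ₁, threeBlock_mul _ _ pℓ₂ pn₂,
    threeBlock_mul _ _ pℓ₂ pm₂] at hE hA hB
  obtain ⟨R, hR⟩ := exists_mul_eq_one_of_rank_eq_card _
    (hQ₁.first.2.1.trans (Fintype.card_fin _).symm)
  obtain ⟨R₁, hR₁, -⟩ := hQ₁.second.exists_inverse
  obtain ⟨R₂, hR₂, hR₂'⟩ := hQ₂.second.exists_inverse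
  have e₁10 := hQ₁.E_upper 1 0 (by decide)
  have e₁20 := hQ₁.E_upper 2 0 (by decide)
  have e₁21 := hQ₁.E_upper 2 1 (by decide)
  have a₁10 := hQ₁.A_upper 1 0 (by decide)
  have a₁20 := hQ₁.A_upper 2 0 (by decide)
  have a₁21 := hQ₁.A_upper 2 1 (by decide)
  have e₂10 := hQ₂.E_upper 1 0 (by decide)
  have e₂20 := hQ₂.E_upper 2 0 (by decide)
  have e₂21 := hQ₂.E_upper 2 1 (by decide)
  have a₂10 := hQ₂.A_upper 1 0 (by decide)
  have a₂20 := hQ₂.A_upper 2 0 (by decide)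
  have a₂21 := hQ₂.A_upper 2 1 (by decide)
  have br₁ := hQ₁.B_row
  have br₂ := hQ₂.B_row
  have bc₁ := hQ₁.B_col
  have bc₂ := hQ₂.B_col
  have b₁ := hQ₁.B_corner
  have b₂ := hQ₂.B_corner
  have hE20 := hE 2 0
  have hA20 := hA 2 0
  simp only [e₁10, e₁20, e₂20, e₂21, a₁10, a₁20, a₂20, a₂21, bc₂, b₂, Matrix.mul_zero,
    Matrix.zero_mul, zero_add, add_zero] at hE20 hA20
  obtain ⟨S20, T20, F20⟩ := hQ₂.third.eq_zero_of_rightInverse hR hE20 hA20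
  have hE21 := hE 2 1
  have hA21 := hA 2 1
  simp only [S20, e₁21, e₂20, e₂21, a₁21, a₂20, a₂21, bc₂, b₂, Matrix.mul_zero,
    Matrix.zero_mul, zero_add, add_zero] at hE21 hA21
  obtain ⟨S21, T21, F21⟩ := hQ₂.third.eq_zero_of_rightInverse hR₁ hE21 hA21
  have hE10 := hE 1 0
  have hA10 := hA 1 0
  have hB10 := hB 1 0
  simp only [T20, e₁10, e₁20, e₂10, a₁10, a₁20, a₂10, br₁, br₂, b₁, Matrix.mul_zero,
    Matrix.zero_mul, zero_add, add_zero] at hE10 hA10 hB10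
  -- Since E₂₂ of the second system is invertible, T is eliminated, leaving K A = N K E and K B = 0
  -- on the controllable block, with K the (1,0) block of S.
  have hT : T.threeBlock pn₂ pn₁ 1 0 = R₂ * (S.threeBlock pℓ₂ pℓ₁ 1 0 *
      G₁.E.threeBlock pℓ₁ pn₁ 0 0) := by
    rw [hE10, ← Matrix.mul_assoc]
    exact (Matrix.one_mul _).symm.trans (congrArg (· * _) hR₂'.symm)
  have S10 : S.threeBlock pℓ₂ pℓ₁ 1 0 = 0 := by
    refine eq_zero_of_rank_complexPencil hQ₁.first.2.2.1
      (N := G₂.A.threeBlock pℓ₂ pn₂ 1 1 * R₂) ?_ hB10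
    rw [Matrix.mul_assoc]
    exact hA10.trans (congrArg _ hT)
  have T10 : T.threeBlock pn₂ pn₁ 1 0 = 0 := by
    rw [hT, S10, Matrix.zero_mul, Matrix.mul_zero]
  have hB20 := hB 2 0
  have hB21 := hB 2 1
  have hB01 := hB 0 1
  simp only [S20, br₁, bc₁, b₁, bc₂, b₂, Matrix.mul_zero,
    Matrix.zero_mul, zero_add, add_zero] at hB20 hB21 hB01
  have V20 := hQ₂.third.mul_B_eq_zero hB20.symm
  have V21 := hQ₂.third.mul_B_eq_zero hB21.symm
  rw [V21, Matrix.mul_zero, add_zero] at hB01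
  have V01 := eq_zero_of_mul_eq_zero_of_rank_eq_card _
    (hQ₂.first.2.2.2.trans (Fintype.card_fin _).symm) hB01.symm
  exact ⟨S10, S20, S21, T10, T20, T21, V01, V20, V21, F20⟩

/-- Diagonal blocks of a product of triangular matrices multiply; for V triangularity is with
respect to the block order 1, 0, 2. -/
theorem BlockPattern.diag_mul_eq_one {S' : Matrix (Fin ℓ) (Fin ℓ) ℝ}
    {T' : Matrix (Fin n) (Fin n) ℝ} {V' : Matrix (Fin m) (Fin m) ℝ} {F' : Matrix (Fin m) (Fin n) ℝ}
    (h : BlockPattern pℓ₁ pℓ₂ pn₁ pn₂ pm₁ pm₂ S T V F)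
    (h' : BlockPattern pℓ₂ pℓ₁ pn₂ pn₁ pm₂ pm₁ S' T' V' F')
    (hS : S * S' = 1) (hT : T * T' = 1) (hV : V * V' = 1) (k : Fin 3) :
    S.threeBlock pℓ₂ pℓ₁ k k * S'.threeBlock pℓ₁ pℓ₂ k k = 1 ∧
    T.threeBlock pn₂ pn₁ k k * T'.threeBlock pn₁ pn₂ k k = 1 ∧
    V.threeBlock pm₂ pm₁ k k * V'.threeBlock pm₁ pm₂ k k = 1 := by
  rw [← threeBlock_one pℓ₂, ← threeBlock_one pn₂, ← threeBlock_one pm₂, ← hS, ← hT, ← hV,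
    threeBlock_mul S S' pℓ₂ pℓ₁, threeBlock_mul T T' pn₂ pn₁, threeBlock_mul V V' pm₂ pm₁]
  fin_cases k <;>
  simp [h.S10, h.S20, h.S21, h.T10, h.T20, h.T21, h.V01, h.V20, h.V21,
    h'.S10, h'.S20, h'.S21, h'.T10, h'.T20, h'.T21, h'.V01, h'.V20, h'.V21]

/-- The zero pattern kills all cross terms. In particular F₂₀ = 0 and V₂₀ = 0 remove the
contribution of the coupling block (0,2) of `G₂.B` to the first diagonal block. -/
theorem Intertwines.diagBlock (h : G₁.Intertwines G₂ S T V F)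
    (hQ₁ : G₁.IsQPFF pℓ₁ pn₁ pm₁) (hQ₂ : G₂.IsQPFF pℓ₂ pn₂ pm₂) (k : Fin 3) :
    (G₁.diagBlock pℓ₁ pn₁ pm₁ k).Intertwines (G₂.diagBlock pℓ₂ pn₂ pm₂ k)
      (S.threeBlock pℓ₂ pℓ₁ k k) (T.threeBlock pn₂ pn₁ k k) (V.threeBlock pm₂ pm₁ k k)
      (F.threeBlock pm₂ pn₁ k k) := by
  have P := h.blockPattern hQ₁ hQ₂
  have hE := congrArg (fun M : Matrix _ _ ℝ => M.threeBlock pℓ₂ pn₁ k k) h.E_eq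
  have hA := congrArg (fun M : Matrix _ _ ℝ => M.threeBlock pℓ₂ pn₁ k k) h.A_eq
  have hB := congrArg (fun M : Matrix _ _ ℝ => M.threeBlock pℓ₂ pm₁ k k) h.B_eq
  simp only [threeBlock_add, threeBlock_mul _ _ pℓ₂ pℓ₁, threeBlock_mul _ _ pℓ₂ pn₂,
    threeBlock_mul _ _ pℓ₂ pm₂] at hE hA hB
  constructor
  · change _ * G₁.E.threeBlock pℓ₁ pn₁ k k = G₂.E.threeBlock pℓ₂ pn₂ k k * _
    fin_cases k <;>
    simpa [P.S10, P.S20, P.S21, P.T10, P.T20, P.T21, hQ₁.E_upper, hQ₂.E_upper] using hE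
  · change _ * G₁.A.threeBlock pℓ₁ pn₁ k k = G₂.A.threeBlock pℓ₂ pn₂ k k * _ +
      G₂.B.threeBlock pℓ₂ pm₂ k k * _
    fin_cases k <;>
    simpa [P.S10, P.S20, P.S21, P.T10, P.T20, P.T21, P.F20, hQ₁.A_upper, hQ₂.A_upper, hQ₂.B_row,
      hQ₂.B_col, hQ₂.B_corner] using hA
  · change _ * G₁.B.threeBlock pℓ₁ pm₁ k k = G₂.B.threeBlock pℓ₂ pm₂ k k * _
    fin_cases k
    · simpa [P.V20, hQ₁.B_row, hQ₁.B_corner, hQ₂.B_col] using hB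
    · simp [hQ₁.B_row, hQ₂.B_row]
    · simpa [P.S20, hQ₁.B_row, hQ₂.B_col, hQ₂.B_corner] using hB

end QPFF

end ControlSystem

theorem proposition3p15 {ℓ n m : ℕ} (G G₁ G₂ : ControlSystem ℓ n m)
    (pℓ₁ pℓ₂ : ThreeBlocks ℓ) (pn₁ pn₂ : ThreeBlocks n) (pm₁ pm₂ : ThreeBlocks m)
    (hG₁ : G.PFeedbackEquiv G₁) (hG₂ : G.PFeedbackEquiv G₂)
    (hQ₁ : G₁.IsQPFF pℓ₁ pn₁ pm₁) (hQ₂ : G₂.IsQPFF pℓ₂ pn₂ pm₂) :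
    ∀ k : Fin 3, ∃ (hℓ : pℓ₁.size k = pℓ₂.size k) (hn : pn₁.size k = pn₂.size k)
      (hm : pm₁.size k = pm₂.size k),
      ((G₁.diagBlock pℓ₁ pn₁ pm₁ k).cast hℓ hn hm).PFeedbackEquiv
        (G₂.diagBlock pℓ₂ pn₂ pm₂ k) := by
  intro k
  obtain ⟨S₁, T₁, V₁, F₁, h₁⟩ := hG₁.exists_eq
  obtain ⟨S₂, T₂, V₂, F₂, h₂⟩ := hG₂.exists_eq
  have hinv : ∀ {a : ℕ} (U : Matrix.GeneralLinearGroup (Fin a) ℝ),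
      U.val * U⁻¹.val = 1 ∧ U⁻¹.val * U.val = 1 := fun U => ⟨U.val_inv, U.inv_val⟩
  have h₁' := h₁.symm (hinv S₁).1 (hinv T₁).1 (hinv V₁).1
  have h := h₁'.comp h₂
  have hS := hinv (S₂⁻¹ * S₁)
  have hT := hinv (T₂ * T₁⁻¹)
  have hV := hinv (V₂ * V₁⁻¹)
  have h' := h.symm hS.2 hT.1 hV.1
  have P := h.blockPattern hQ₁ hQ₂
  have P' := h'.blockPattern hQ₂ hQ₁
  -- The diagonal blocks are a priori rectangular, so inverses on both sides are needed to conclude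
  -- that the sizes agree.
  obtain ⟨s, t, v⟩ := P.diag_mul_eq_one P' hS.1 hT.1 hV.1 k
  obtain ⟨s', t', v'⟩ := P'.diag_mul_eq_one P hS.2 hT.2 hV.2 k
  exact (h.diagBlock hQ₁ hQ₂ k).exists_cast_pFeedbackEquiv s s' t t' v v'
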